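/- For a bounded self-adjoint operator $A$ on a complex Hilbert space, let $N_-(A)\in\{0,1,2,\dots\}\cup\{\infty\}$ denote the total multiplicity of its strictly negative spectrum, that is, the dimension of the range of the spectral projection $E_A((-\infty,0))$. A bounded operator $H$ on the complex space $L^2(\mathbb R_+)$, $\mathbb R_+=(0,\infty)$, is called a Hankel operator with kernel $h\in L^1_{\mathrm{loc}}(\mathbb R_+)$ if $$(Hf)(t)=\int_0^\infty h(t+s)f(s)\,ds$$ for almost all $t>0$ and every continuous $f$ with compact support in $\mathbb R_+$. **Theorem.** Let $H_0$ be the Carleman operator on $L^2(\mathbb R_+)$, that is, the (bounded, self-adjoint) Hankel operator with kernel $h_0(t)=t^{-1}$. Let $V$ be a self-adjoint Hankel operator of finite rank on $L^2(\mathbb R_+)$, and let $H=H_0+V$. Then $$N_-(H)=N_-(V).$$ In particular, $H\ge 0$ if and only if $V\ge 0$. -/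

import Mathlib

open MeasureTheory Set Filter
open scoped ENNReal

noncomputable section

namespace FiniteRankHankel

/-- Lebesgue measure on the half-line `ℝ₊ = (0, ∞)`. -/
abbrev halfLine : Measure ℝ := volume.restrict (Ioi 0)

/-- The complex Hilbert space `L²(ℝ₊)`. -/
abbrev L2Pos : Type := Lp ℂ 2 halfLine

/-- The bounded operator `H` on `L²(ℝ₊)` is the Hankel operator with kernel `h`, i.e. the integral
operator `(H f)(t) = ∫₀^∞ h(t + s) f(s) ds`. The kernel is a locally integrable function on
`(0, ∞)`, and the formula is required on the dense set of continuous functions `f` with compact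
support in `(0, ∞)`, for which the integral converges absolutely for every `t > 0`. -/
def HasHankelKernel (H : L2Pos →L[ℂ] L2Pos) (h : ℝ → ℂ) : Prop :=
  LocallyIntegrableOn h (Ioi 0) ∧
    ∀ φ : ℝ → ℂ, Continuous φ → HasCompactSupport φ → tsupport φ ⊆ Ioi 0 →
      ∀ f : L2Pos, f =ᵐ[halfLine] φ →
        H f =ᵐ[halfLine] fun t => ∫ s in Ioi (0 : ℝ), h (t + s) * φ s

/-- A (bounded) Hankel operator on `L²(ℝ₊)`. -/
def IsHankel (H : L2Pos →L[ℂ] L2Pos) : Prop :=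
  ∃ h : ℝ → ℂ, HasHankelKernel H h

/-- An operator of finite rank. -/
def HasFiniteRank (H : L2Pos →L[ℂ] L2Pos) : Prop :=
  FiniteDimensional ℂ (LinearMap.range (H : L2Pos →ₗ[ℂ] L2Pos))

section Multiplicity

variable {E : Type*} [NormedAddCommGroup E] [InnerProductSpace ℂ E] [CompleteSpace E]

/-- The spectral subspace of a bounded self-adjoint operator `A` for the half-line `(-∞, 0)`, i.e.
the range of the spectral projection `E_A((-∞, 0))`. The negative part is given by the functional
calculus, `A⁻ = ∫_{(-∞, 0)} |λ| dE_A(λ)`, and the closure of its range is exactly the range of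
`E_A((-∞, 0))`. -/
def negativeSpectralSubspace (A : E →L[ℂ] E) : Submodule ℂ E :=
  (LinearMap.range ((A⁻ : E →L[ℂ] E) : E →ₗ[ℂ] E)).topologicalClosure

/-- `N₋(A)`: the total multiplicity of the strictly negative spectrum of a bounded self-adjoint
operator `A`, a natural number or `∞`. -/
def negativeMultiplicity (A : E →L[ℂ] E) : ℕ∞ :=
  Cardinal.toENat (Module.rank ℂ (negativeSpectralSubspace A))

end Multiplicity

/-! ### The Carleman operator -/

lemma lintegral_rpow_bound {t : ℝ} (ht : 0 < t) :
    ∫⁻ s in Ioi (0 : ℝ), ENNReal.ofReal ((t + s)⁻¹ * s ^ (-(1 / 2) : ℝ)) ≤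
      ENNReal.ofReal (4 * t ^ (-(1 / 2) : ℝ)) := by
  have hsplit : Ioi (0 : ℝ) = Ioc 0 t ∪ Ioi t := (Ioc_union_Ioi_eq_Ioi ht.le).symm
  have h1 : ∫⁻ s in Ioc (0 : ℝ) t, ENNReal.ofReal ((t + s)⁻¹ * s ^ (-(1 / 2) : ℝ)) ≤
      ENNReal.ofReal (2 * t ^ (-(1 / 2) : ℝ)) := by
    have hi : IntervalIntegrable (fun s : ℝ => t⁻¹ * s ^ (-(1 / 2) : ℝ)) volume 0 t :=
      (intervalIntegral.intervalIntegrable_rpow' (by norm_num)).const_mul _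
    have hi' := (intervalIntegrable_iff_integrableOn_Ioc_of_le ht.le).1 hi
    calc _ ≤ ∫⁻ s in Ioc (0 : ℝ) t, ENNReal.ofReal (t⁻¹ * s ^ (-(1 / 2) : ℝ)) := by
          refine setLIntegral_mono' measurableSet_Ioc fun s hs => ENNReal.ofReal_le_ofReal ?_
          have : (t + s)⁻¹ ≤ t⁻¹ := inv_anti₀ ht (by linarith [hs.1])
          exact mul_le_mul_of_nonneg_right this (Real.rpow_nonneg hs.1.le _)
      _ = ENNReal.ofReal (∫ s in Ioc (0 : ℝ) t, t⁻¹ * s ^ (-(1 / 2) : ℝ)) := by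
          rw [ofReal_integral_eq_lintegral_ofReal hi']
          refine (ae_restrict_iff' measurableSet_Ioc).2 (Eventually.of_forall fun s hs => ?_)
          exact mul_nonneg (inv_nonneg.2 ht.le) (Real.rpow_nonneg hs.1.le _)
      _ ≤ _ := by
          refine ENNReal.ofReal_le_ofReal (le_of_eq ?_)
          rw [← intervalIntegral.integral_of_le ht.le, intervalIntegral.integral_const_mul,
            integral_rpow (Or.inl (by norm_num)), Real.zero_rpow (by norm_num)]
          have : t ^ (-(1 / 2) : ℝ) = t⁻¹ * t ^ (-(1 / 2) + 1 : ℝ) := by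
            rw [Real.rpow_add ht, Real.rpow_one]; field_simp
          rw [this]; ring
  have h2 : ∫⁻ s in Ioi t, ENNReal.ofReal ((t + s)⁻¹ * s ^ (-(1 / 2) : ℝ)) ≤
      ENNReal.ofReal (2 * t ^ (-(1 / 2) : ℝ)) := by
    have hi' := integrableOn_Ioi_rpow_of_lt (a := (-(3 / 2) : ℝ)) (by norm_num) ht
    calc _ ≤ ∫⁻ s in Ioi t, ENNReal.ofReal (s ^ (-(3 / 2) : ℝ)) := by
          refine setLIntegral_mono' measurableSet_Ioi fun s hs => ENNReal.ofReal_le_ofReal ?_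
          have hs0 : 0 < s := ht.trans hs
          have h3 : (t + s)⁻¹ ≤ s⁻¹ := inv_anti₀ hs0 (by linarith)
          have h4 : s ^ (-(3 / 2) : ℝ) = s⁻¹ * s ^ (-(1 / 2) : ℝ) := by
            rw [← Real.rpow_neg_one, ← Real.rpow_add hs0]; norm_num
          rw [h4]
          exact mul_le_mul_of_nonneg_right h3 (Real.rpow_nonneg hs0.le _)
      _ = ENNReal.ofReal (∫ s in Ioi t, s ^ (-(3 / 2) : ℝ)) := by
          rw [ofReal_integral_eq_lintegral_ofReal hi']
          refine (ae_restrict_iff' measurableSet_Ioi).2 (Eventually.of_forall fun s hs => ?_)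
          exact Real.rpow_nonneg (ht.trans hs).le _
      _ ≤ _ := by
          refine ENNReal.ofReal_le_ofReal (le_of_eq ?_)
          rw [integral_Ioi_rpow_of_lt (by norm_num) ht]
          norm_num; ring
  rw [hsplit]
  refine (lintegral_union_le _ _ _).trans ((add_le_add h1 h2).trans (le_of_eq ?_))
  have := Real.rpow_nonneg ht.le (-(1 / 2) : ℝ)
  rw [← ENNReal.ofReal_add (by positivity) (by positivity)]
  congr 1; ring

lemma schur_pointwise {F : ℝ → ℝ≥0∞} (hF : AEMeasurable F halfLine) {t : ℝ} (ht : 0 < t) :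
    (∫⁻ s in Ioi (0 : ℝ), ENNReal.ofReal (t + s)⁻¹ * F s) ^ 2 ≤
      ∫⁻ s in Ioi (0 : ℝ), ENNReal.ofReal (4 * t ^ (-(1 / 2) : ℝ) * ((t + s)⁻¹ * s ^ (1 / 2 : ℝ))) *
        F s ^ 2 := by
  set a : ℝ → ℝ≥0∞ := fun s => ENNReal.ofReal (√((t + s)⁻¹ * s ^ (-(1 / 2) : ℝ)))
  set b : ℝ → ℝ≥0∞ := fun s => ENNReal.ofReal (√((t + s)⁻¹ * s ^ (1 / 2 : ℝ))) * F s
  have ha : AEMeasurable a halfLine := by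
    refine Measurable.aemeasurable ?_
    simp only [a]; fun_prop
  have hb : AEMeasurable b halfLine := by
    refine AEMeasurable.mul (Measurable.aemeasurable ?_) hF
    fun_prop
  have hab : ∫⁻ s in Ioi (0 : ℝ), ENNReal.ofReal (t + s)⁻¹ * F s = ∫⁻ s, (a * b) s ∂halfLine := by
    refine setLIntegral_congr_fun measurableSet_Ioi fun s hs => ?_
    have hs : 0 < s := hs
    simp only [Pi.mul_apply, a, b]
    rw [← mul_assoc, ← ENNReal.ofReal_mul (Real.sqrt_nonneg _), ← Real.sqrt_mul (by positivity)]
    congr 2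
    have : (t + s)⁻¹ * s ^ (-(1 / 2) : ℝ) * ((t + s)⁻¹ * s ^ (1 / 2 : ℝ)) = (t + s)⁻¹ ^ 2 := by
      have : s ^ (-(1 / 2) : ℝ) * s ^ (1 / 2 : ℝ) = 1 := by
        rw [← Real.rpow_add hs]; norm_num
      linear_combination (t + s)⁻¹ ^ 2 * this
    rw [this, Real.sqrt_sq (by positivity)]
  have hsq : ∀ x : ℝ≥0∞, (x ^ (1 / 2 : ℝ)) ^ 2 = x := fun x => by
    rw [← ENNReal.rpow_natCast, ← ENNReal.rpow_mul]; norm_num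
  have hcs := ENNReal.lintegral_mul_le_Lp_mul_Lq halfLine Real.HolderConjugate.two_two ha hb
  have hcs2 := pow_le_pow_left' hcs 2
  rw [mul_pow, hsq, hsq] at hcs2
  rw [hab]
  refine hcs2.trans ?_
  have hA : ∫⁻ s, a s ^ (2 : ℝ) ∂halfLine ≤ ENNReal.ofReal (4 * t ^ (-(1 / 2) : ℝ)) := by
    refine le_trans (le_of_eq ?_) (lintegral_rpow_bound ht)
    refine setLIntegral_congr_fun measurableSet_Ioi fun s hs => ?_
    have hs : 0 < s := hs
    simp only [a, ENNReal.rpow_two]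
    rw [← ENNReal.ofReal_pow (Real.sqrt_nonneg _), Real.sq_sqrt (by positivity)]
  refine (mul_le_mul_left hA _).trans ?_
  rw [← lintegral_const_mul' _ _ ENNReal.ofReal_ne_top]
  refine le_of_eq (setLIntegral_congr_fun measurableSet_Ioi fun s hs => ?_)
  have hs : 0 < s := hs
  simp only [b, ENNReal.rpow_two]
  rw [mul_pow, ← ENNReal.ofReal_pow (Real.sqrt_nonneg _), Real.sq_sqrt (by positivity), ← mul_assoc,
    ← ENNReal.ofReal_mul (by positivity)]

/-- The Schur test for the kernel `(t + s)⁻¹`. -/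
lemma schur_bound {F : ℝ → ℝ≥0∞} (hF : AEMeasurable F halfLine) :
    ∫⁻ t in Ioi (0 : ℝ), (∫⁻ s in Ioi (0 : ℝ), ENNReal.ofReal (t + s)⁻¹ * F s) ^ 2 ≤
      16 * ∫⁻ s in Ioi (0 : ℝ), F s ^ 2 := by
  calc _ ≤ ∫⁻ t in Ioi (0 : ℝ), ∫⁻ s in Ioi (0 : ℝ),
        ENNReal.ofReal (4 * t ^ (-(1 / 2) : ℝ) * ((t + s)⁻¹ * s ^ (1 / 2 : ℝ))) * F s ^ 2 :=
        setLIntegral_mono' measurableSet_Ioi fun t ht => schur_pointwise hF ht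
    _ = ∫⁻ s in Ioi (0 : ℝ), ∫⁻ t in Ioi (0 : ℝ),
        ENNReal.ofReal (4 * t ^ (-(1 / 2) : ℝ) * ((t + s)⁻¹ * s ^ (1 / 2 : ℝ))) * F s ^ 2 := by
        refine lintegral_lintegral_swap ?_
        refine AEMeasurable.mul (Measurable.aemeasurable ?_) ((hF.comp_snd).pow_const 2)
        fun_prop
    _ ≤ ∫⁻ s in Ioi (0 : ℝ), 16 * F s ^ 2 := by
        refine setLIntegral_mono' measurableSet_Ioi fun s hs => ?_
        have hs : 0 < s := hs
        rw [lintegral_mul_const _ (by fun_prop)]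
        refine mul_le_mul_left ?_ _
        calc _ = ∫⁻ t in Ioi (0 : ℝ), ENNReal.ofReal (4 * s ^ (1 / 2 : ℝ)) *
              ENNReal.ofReal ((s + t)⁻¹ * t ^ (-(1 / 2) : ℝ)) := by
              refine lintegral_congr fun t => ?_
              rw [← ENNReal.ofReal_mul (by positivity), add_comm s t]
              congr 1; ring
          _ ≤ ENNReal.ofReal (4 * s ^ (1 / 2 : ℝ)) * ENNReal.ofReal (4 * s ^ (-(1 / 2) : ℝ)) := by
              rw [lintegral_const_mul' _ _ ENNReal.ofReal_ne_top]
              exact mul_le_mul_right (lintegral_rpow_bound hs) _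
          _ = 16 := by
              rw [← ENNReal.ofReal_mul (by positivity)]
              have : s ^ (1 / 2 : ℝ) * s ^ (-(1 / 2) : ℝ) = 1 := by
                rw [← Real.rpow_add hs]; norm_num
              have h16 : 4 * s ^ (1 / 2 : ℝ) * (4 * s ^ (-(1 / 2) : ℝ)) = 16 := by
                linear_combination 16 * this
              rw [h16]; norm_num
    _ = _ := lintegral_const_mul' _ _ (by norm_num)

/-- The function `t ↦ ∫₀^∞ (t + s)⁻¹ f(s) ds`. -/
def carlemanFun (f : L2Pos) (t : ℝ) : ℂ := ∫ s in Ioi (0 : ℝ), (((t + s)⁻¹ : ℝ) : ℂ) * f s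

lemma eLpNorm_two_sq (g : ℝ → ℂ) :
    eLpNorm g 2 halfLine ^ 2 = ∫⁻ s in Ioi (0 : ℝ), ‖g s‖ₑ ^ 2 := by
  rw [eLpNorm_eq_lintegral_rpow_enorm_toReal (by norm_num) (by norm_num), ← ENNReal.rpow_natCast,
    ← ENNReal.rpow_mul]
  norm_num

lemma aemeasurable_enorm (f : L2Pos) : AEMeasurable (fun s => ‖f s‖ₑ) halfLine :=
  (Lp.aestronglyMeasurable f).enorm

lemma lintegral_sq_lt_top (f : L2Pos) : ∫⁻ s in Ioi (0 : ℝ), ‖f s‖ₑ ^ 2 < ∞ := by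
  rw [← eLpNorm_two_sq]
  exact ENNReal.pow_lt_top (Lp.eLpNorm_lt_top f)

lemma enorm_kernel_mul (f : L2Pos) {t s : ℝ} (ht : 0 < t) (hs : 0 < s) :
    ‖(((t + s)⁻¹ : ℝ) : ℂ) * f s‖ₑ = ENNReal.ofReal (t + s)⁻¹ * ‖f s‖ₑ := by
  rw [enorm_mul]
  congr 1
  rw [← ofReal_norm, Complex.norm_real, Real.norm_of_nonneg (by positivity)]

lemma aestronglyMeasurable_kernel_mul (f : L2Pos) :
    AEStronglyMeasurable (fun p : ℝ × ℝ => (((p.1 + p.2)⁻¹ : ℝ) : ℂ) * f p.2)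
      (halfLine.prod halfLine) := by
  refine AEStronglyMeasurable.mul (Measurable.aestronglyMeasurable ?_)
    (Lp.aestronglyMeasurable f).comp_snd
  fun_prop

lemma enorm_carlemanFun_le (f : L2Pos) {t : ℝ} (ht : 0 < t) :
    ‖carlemanFun f t‖ₑ ≤ ∫⁻ s in Ioi (0 : ℝ), ENNReal.ofReal (t + s)⁻¹ * ‖f s‖ₑ :=
  (enorm_integral_le_lintegral_enorm _).trans (le_of_eq
    (setLIntegral_congr_fun measurableSet_Ioi fun _ hs => enorm_kernel_mul f ht hs))

lemma eLpNorm_carlemanFun_le (f : L2Pos) :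
    eLpNorm (carlemanFun f) 2 halfLine ≤ 4 * eLpNorm f 2 halfLine := by
  have h : eLpNorm (carlemanFun f) 2 halfLine ^ 2 ≤ (4 * eLpNorm f 2 halfLine) ^ 2 := by
    rw [mul_pow, eLpNorm_two_sq, eLpNorm_two_sq]
    refine (setLIntegral_mono' measurableSet_Ioi fun t ht =>
      pow_le_pow_left' (enorm_carlemanFun_le f ht) 2).trans
      ((schur_bound (aemeasurable_enorm f)).trans (le_of_eq ?_))
    norm_num
  exact (ENNReal.pow_le_pow_left_iff two_ne_zero).1 h

lemma memLp_carlemanFun (f : L2Pos) : MemLp (carlemanFun f) 2 halfLine :=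
  ⟨(aestronglyMeasurable_kernel_mul f).integral_prod_right',
    (eLpNorm_carlemanFun_le f).trans_lt (ENNReal.mul_lt_top (by norm_num) (Lp.eLpNorm_lt_top f))⟩

lemma ae_integrable_kernel_mul (f : L2Pos) :
    ∀ᵐ t ∂halfLine, Integrable (fun s => (((t + s)⁻¹ : ℝ) : ℂ) * f s) halfLine := by
  have hmeas : AEMeasurable
      (fun t => (∫⁻ s in Ioi (0 : ℝ), ENNReal.ofReal (t + s)⁻¹ * ‖f s‖ₑ) ^ 2) halfLine := by
    refine AEMeasurable.pow_const (AEMeasurable.lintegral_prod_right'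
      (f := fun p : ℝ × ℝ => ENNReal.ofReal (p.1 + p.2)⁻¹ * ‖f p.2‖ₑ) ?_) 2
    exact AEMeasurable.mul (Measurable.aemeasurable (by fun_prop)) (aemeasurable_enorm f).comp_snd
  have hfin := ae_lt_top' hmeas ((schur_bound (aemeasurable_enorm f)).trans_lt
    (ENNReal.mul_lt_top (by norm_num) (lintegral_sq_lt_top f))).ne
  filter_upwards [hfin, ae_restrict_mem measurableSet_Ioi] with t ht ht0
  refine ⟨AEStronglyMeasurable.mul (Measurable.aestronglyMeasurable (by fun_prop))
    (Lp.aestronglyMeasurable f), ?_⟩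
  rw [hasFiniteIntegral_iff_enorm,
    setLIntegral_congr_fun measurableSet_Ioi fun s hs => enorm_kernel_mul f ht0 hs]
  by_contra h
  rw [not_lt, top_le_iff] at h
  rw [h] at ht
  simp at ht

/-- The Carleman operator `H₀` on `L²(ℝ₊)`: `(H₀ f)(t) = ∫₀^∞ (t + s)⁻¹ f(s) ds`. -/
def carleman : L2Pos →L[ℂ] L2Pos :=
  LinearMap.mkContinuous
    { toFun := fun f => (memLp_carlemanFun f).toLp (carlemanFun f)
      map_add' := fun f g => by
        rw [← MemLp.toLp_add]
        refine MemLp.toLp_congr _ _ ?_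
        filter_upwards [ae_integrable_kernel_mul f, ae_integrable_kernel_mul g] with t hf hg
        simp only [Pi.add_apply, carlemanFun]
        rw [← integral_add hf hg]
        refine integral_congr_ae ?_
        filter_upwards [Lp.coeFn_add f g] with s hs
        rw [hs, Pi.add_apply, mul_add]
      map_smul' := fun c f => by
        rw [RingHom.id_apply, ← MemLp.toLp_const_smul]
        refine MemLp.toLp_congr _ _ (Eventually.of_forall fun t => ?_)
        simp only [Pi.smul_apply, carlemanFun]
        rw [← integral_smul]
        refine integral_congr_ae ?_
        filter_upwards [Lp.coeFn_smul c f] with s hs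
        rw [hs, Pi.smul_apply, smul_eq_mul, smul_eq_mul]
        ring }
    4
    (fun f => by
      rw [LinearMap.coe_mk, AddHom.coe_mk, Lp.norm_toLp, Lp.norm_def]
      have h := ENNReal.toReal_mono
        (ENNReal.mul_lt_top (by norm_num) (Lp.eLpNorm_lt_top f)).ne (eLpNorm_carlemanFun_le f)
      rw [ENNReal.toReal_mul] at h
      simpa using h)

lemma carleman_apply (f : L2Pos) : carleman f =ᵐ[halfLine] carlemanFun f :=
  MemLp.coeFn_toLp (memLp_carlemanFun f)

/-- The Carleman operator is the Hankel operator with kernel `t⁻¹`. -/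
theorem carleman_hasHankelKernel : HasHankelKernel carleman fun t => ((t⁻¹ : ℝ) : ℂ) := by
  refine ⟨ContinuousOn.locallyIntegrableOn ?_ measurableSet_Ioi, fun φ _ _ _ f hf => ?_⟩
  · exact Complex.continuous_ofReal.comp_continuousOn
      (continuousOn_id.inv₀ fun t ht => (ne_of_gt ht))
  · refine (carleman_apply f).trans (Eventually.of_forall fun t => ?_)
    refine integral_congr_ae ?_
    filter_upwards [hf] with s hs
    rw [hs]

lemma integrable_kernel_form (f g : L2Pos) :
    Integrable (Function.uncurry fun t s : ℝ =>
      g t * ((((t + s)⁻¹ : ℝ) : ℂ) * (starRingEnd ℂ) (f s))) (halfLine.prod halfLine) := by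
  have hmeasF : AEMeasurable (fun p : ℝ × ℝ => ENNReal.ofReal (p.1 + p.2)⁻¹ * ‖f p.2‖ₑ)
      (halfLine.prod halfLine) :=
    AEMeasurable.mul (Measurable.aemeasurable (by fun_prop)) (aemeasurable_enorm f).comp_snd
  have hmeas : AEStronglyMeasurable (Function.uncurry fun t s : ℝ =>
      g t * ((((t + s)⁻¹ : ℝ) : ℂ) * (starRingEnd ℂ) (f s))) (halfLine.prod halfLine) := by
    refine (Lp.aestronglyMeasurable g).comp_fst.mul (AEStronglyMeasurable.mul
      (Measurable.aestronglyMeasurable (by fun_prop)) ?_)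
    exact Complex.continuous_conj.comp_aestronglyMeasurable (Lp.aestronglyMeasurable f).comp_snd
  refine ⟨hmeas, ?_⟩
  rw [hasFiniteIntegral_iff_enorm, lintegral_prod _ hmeas.enorm]
  have hEq : ∫⁻ t in Ioi (0 : ℝ), ∫⁻ s in Ioi (0 : ℝ), ‖Function.uncurry (fun t s : ℝ =>
      g t * ((((t + s)⁻¹ : ℝ) : ℂ) * (starRingEnd ℂ) (f s))) (t, s)‖ₑ =
      ∫⁻ t in Ioi (0 : ℝ), ((fun t => ‖g t‖ₑ) *
        fun t => ∫⁻ s in Ioi (0 : ℝ), ENNReal.ofReal (t + s)⁻¹ * ‖f s‖ₑ) t := by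
    refine setLIntegral_congr_fun measurableSet_Ioi fun t ht => ?_
    simp only [Pi.mul_apply]
    rw [← lintegral_const_mul' _ _ enorm_ne_top]
    refine setLIntegral_congr_fun measurableSet_Ioi fun s hs => ?_
    rw [← enorm_kernel_mul f ht hs]
    simp only [Function.uncurry, enorm_mul, RCLike.enorm_conj]
  rw [hEq]
  refine (ENNReal.lintegral_mul_le_Lp_mul_Lq halfLine Real.HolderConjugate.two_two
    (aemeasurable_enorm g) hmeasF.lintegral_prod_right').trans_lt ?_
  simp only [ENNReal.rpow_two]
  refine ENNReal.mul_lt_top (ENNReal.rpow_lt_top_of_nonneg (by norm_num) (lintegral_sq_lt_top g).ne)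
    (ENNReal.rpow_lt_top_of_nonneg (by norm_num) ?_)
  exact ((schur_bound (aemeasurable_enorm f)).trans_lt
    (ENNReal.mul_lt_top (by norm_num) (lintegral_sq_lt_top f))).ne

/-- The Carleman operator is self-adjoint. -/
theorem carleman_isSelfAdjoint : IsSelfAdjoint carleman := by
  rw [ContinuousLinearMap.isSelfAdjoint_iff_isSymmetric]
  intro f g
  simp only [ContinuousLinearMap.coe_coe, L2.inner_def, RCLike.inner_apply]
  have h1 : ∫ t in Ioi (0 : ℝ), g t * (starRingEnd ℂ) (carleman f t) =
      ∫ t in Ioi (0 : ℝ), ∫ s in Ioi (0 : ℝ),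
        g t * ((((t + s)⁻¹ : ℝ) : ℂ) * (starRingEnd ℂ) (f s)) := by
    refine integral_congr_ae ?_
    filter_upwards [carleman_apply f] with t ht
    rw [ht, carlemanFun, ← integral_conj, ← integral_const_mul]
    simp only [map_mul, Complex.conj_ofReal]
  have h2 : ∫ s in Ioi (0 : ℝ), carleman g s * (starRingEnd ℂ) (f s) =
      ∫ s in Ioi (0 : ℝ), ∫ t in Ioi (0 : ℝ),
        g t * ((((t + s)⁻¹ : ℝ) : ℂ) * (starRingEnd ℂ) (f s)) := by
    refine integral_congr_ae ?_
    filter_upwards [carleman_apply g] with s hs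
    rw [hs, carlemanFun, ← integral_mul_const]
    refine integral_congr_ae (Eventually.of_forall fun t => ?_)
    simp only [add_comm s t]
    ring
  rw [h1, h2]
  exact integral_integral_swap (integrable_kernel_form f g)

end FiniteRankHankel

end

/-!
The Carleman operator is `ℒ* ℒ`, where `ℒ` is the Laplace transform on `L²(ℝ₊)`, so `N₋(H) ≤ N₋(V)`.
For the converse, the range of a Hankel operator is invariant under the backward shifts
`u ↦ u (· + a)`, and so is the range of `ℒ`: the shift of `ℒ g` is the transform of `e^{-as} g(s)`.
If `ran V` met `ran ℒ` nontrivially, the finite-dimensional intersection would contain a shift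
eigenvector `ℒ g`, forcing `e^{-as} = c` on the support of `g`. Hence `ran V` and `ran ℒ* = ran ℒ`
are disjoint, which says that `ℒ (ker V)` is dense in `ran ℒ`. Every `x` in the negative subspace of
`V` can therefore be corrected by some `k ∈ ker V` so that `ℒ (x - k)` is as small as desired; this
leaves the form of `V` unchanged, so the form of `H` is negative at `x - k`, and Glazman's lemma
gives `N₋(V) ≤ N₋(H)`.
-/

noncomputable section

namespace FiniteRankHankel

open scoped InnerProductSpace NNReal Topology

section NegativeSubspace

variable {E : Type*} [NormedAddCommGroup E] [InnerProductSpace ℂ E] [CompleteSpace E]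
  {A B : E →L[ℂ] E}

lemma isPositive_negPart (A : E →L[ℂ] E) : (A⁻).IsPositive :=
  (ContinuousLinearMap.nonneg_iff_isPositive _).1 (CFC.negPart_nonneg A)

lemma apply_eq_zero_of_reApplyInnerSelf_eq_zero (hA : A.IsPositive) {x : E}
    (hx : A.reApplyInnerSelf x = 0) : A x = 0 := by
  obtain ⟨S, rfl⟩ := CStarAlgebra.nonneg_iff_eq_star_mul_self.1
    ((ContinuousLinearMap.nonneg_iff_isPositive A).2 hA)
  have hS : S x = 0 := by
    rw [← norm_eq_zero, ← sq_eq_zero_iff, ContinuousLinearMap.apply_norm_sq_eq_inner_adjoint_left]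
    exact hx
  rw [mul_apply_eq_comp, hS, map_zero]

lemma orthogonal_negativeSpectralSubspace (A : E →L[ℂ] E) :
    (negativeSpectralSubspace A)ᗮ = (A⁻).ker := by
  rw [negativeSpectralSubspace, Submodule.orthogonal_closure,
    ContinuousLinearMap.orthogonal_range, (isPositive_negPart A).isSelfAdjoint.adjoint_eq]

lemma negativeSpectralSubspace_le_ker_posPart (A : E →L[ℂ] E) :
    negativeSpectralSubspace A ≤ (A⁺).ker := by
  refine Submodule.topologicalClosure_minimal _ ?_ (ContinuousLinearMap.isClosed_ker _)
  rintro _ ⟨y, rfl⟩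
  exact DFunLike.congr_fun (CFC.posPart_mul_negPart A) y

lemma reApplyInnerSelf_eq_posPart_sub_negPart (hA : IsSelfAdjoint A) (x : E) :
    A.reApplyInnerSelf x = (A⁺).reApplyInnerSelf x - (A⁻).reApplyInnerSelf x := by
  conv_lhs => rw [← CFC.posPart_sub_negPart A hA]
  simp only [ContinuousLinearMap.reApplyInnerSelf_apply, sub_apply, inner_sub_left, map_sub]

lemma reApplyInnerSelf_neg_of_mem_negativeSpectralSubspace (hA : IsSelfAdjoint A) {x : E}
    (hx : x ∈ negativeSpectralSubspace A) (hx0 : x ≠ 0) : A.reApplyInnerSelf x < 0 := by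
  have hpos : (A⁺).reApplyInnerSelf x = 0 := by
    have : A⁺ x = 0 := negativeSpectralSubspace_le_ker_posPart A hx
    rw [ContinuousLinearMap.reApplyInnerSelf_apply, this, inner_zero_left, map_zero]
  rw [reApplyInnerSelf_eq_posPart_sub_negPart hA, hpos, zero_sub, neg_lt_zero]
  refine ((isPositive_negPart A).re_inner_nonneg_left x).lt_of_ne' fun hneg => hx0 ?_
  have hker : x ∈ (negativeSpectralSubspace A)ᗮ := by
    rw [orthogonal_negativeSpectralSubspace]
    exact apply_eq_zero_of_reApplyInnerSelf_eq_zero (isPositive_negPart A) hneg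
  exact inner_self_eq_zero.1 (hker x hx)

lemma reApplyInnerSelf_nonneg_of_mem_orthogonal_negativeSpectralSubspace (hA : IsSelfAdjoint A)
    {x : E} (hx : x ∈ (negativeSpectralSubspace A)ᗮ) : 0 ≤ A.reApplyInnerSelf x := by
  have hneg : A⁻ x = 0 := by rwa [orthogonal_negativeSpectralSubspace] at hx
  rw [reApplyInnerSelf_eq_posPart_sub_negPart hA, (A⁻).reApplyInnerSelf_apply, hneg,
    inner_zero_left, map_zero, sub_zero]
  exact ((ContinuousLinearMap.nonneg_iff_isPositive _).1
    (CFC.posPart_nonneg A)).re_inner_nonneg_left x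

/-- **Glazman's lemma**. -/
theorem toENat_rank_le_negativeMultiplicity (hA : IsSelfAdjoint A) {M : Type*} [AddCommGroup M]
    [Module ℂ M] (J : M →ₗ[ℂ] E) (hJ : ∀ m, m ≠ 0 → A.reApplyInnerSelf (J m) < 0) :
    Cardinal.toENat (Module.rank ℂ M) ≤ negativeMultiplicity A := by
  have : CompleteSpace (negativeSpectralSubspace A) :=
    (Submodule.isClosed_topologicalClosure _).completeSpace_coe
  have hinj : Function.Injective
      ((negativeSpectralSubspace A).orthogonalProjectionOnto.toLinearMap ∘ₗ J) := by
    rw [injective_iff_map_eq_zero]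
    intro m hm
    by_contra hm0
    exact (hJ m hm0).not_ge (reApplyInnerSelf_nonneg_of_mem_orthogonal_negativeSpectralSubspace hA
      (Submodule.orthogonalProjectionOnto_eq_zero_iff.1 hm))
  have hrank := OrderHomClass.mono Cardinal.toENat (LinearMap.lift_rank_le_of_injective _ hinj)
  rwa [Cardinal.toENat_lift, Cardinal.toENat_lift] at hrank

lemma isPositive_iff_negativeMultiplicity_eq_zero (hA : IsSelfAdjoint A) :
    A.IsPositive ↔ negativeMultiplicity A = 0 := by
  have hclosed : IsClosed (negativeSpectralSubspace A : Set E) :=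
    Submodule.isClosed_topologicalClosure _
  have := hclosed.completeSpace_coe
  rw [negativeMultiplicity, Cardinal.toENat_eq_zero, Submodule.rank_eq_zero,
    ← Submodule.orthogonal_eq_top_iff, orthogonal_negativeSpectralSubspace,
    LinearMap.ker_eq_top, ← ContinuousLinearMap.nonneg_iff_isPositive,
    ← CFC.negPart_eq_zero_iff A hA]
  exact ContinuousLinearMap.coe_inj.symm

lemma negativeMultiplicity_add_le (hA : A.IsPositive) (hB : IsSelfAdjoint B) :
    negativeMultiplicity (A + B) ≤ negativeMultiplicity B := by
  refine toENat_rank_le_negativeMultiplicity hB (negativeSpectralSubspace (A + B)).subtype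
    fun x hx => ?_
  calc B.reApplyInnerSelf x
      ≤ A.reApplyInnerSelf x + B.reApplyInnerSelf x :=
        le_add_of_nonneg_left (hA.re_inner_nonneg_left _)
    _ = (A + B).reApplyInnerSelf x := by
        simp only [ContinuousLinearMap.reApplyInnerSelf_apply, add_apply,
          inner_add_left, map_add]
    _ < 0 := reApplyInnerSelf_neg_of_mem_negativeSpectralSubspace (hA.isSelfAdjoint.add hB) x.2
        (Submodule.coe_eq_zero.not.2 hx)

end NegativeSubspace

section FiniteRankPerturbation

lemma exists_linearMap_norm_sub_le {𝕜 N W F : Type*} [RCLike 𝕜] [NormedAddCommGroup N]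
    [InnerProductSpace 𝕜 N] [FiniteDimensional 𝕜 N] [AddCommGroup W] [Module 𝕜 W]
    [NormedAddCommGroup F] [NormedSpace 𝕜 F] (T : N →ₗ[𝕜] F) (G : W →ₗ[𝕜] F)
    (hT : ∀ x, T x ∈ (LinearMap.range G).topologicalClosure) {ε : ℝ} (hε : 0 < ε) :
    ∃ K : N →ₗ[𝕜] W, ∀ x, ‖T x - G (K x)‖ ≤ ε * ‖x‖ := by
  let b := stdOrthonormalBasis 𝕜 N
  let δ : ℝ := ε / (Module.finrank 𝕜 N + 1)
  have hδ : 0 < δ := by positivity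
  have happrox : ∀ i, ∃ w, ‖T (b i) - G w‖ < δ := fun i => by
    obtain ⟨_, ⟨w, rfl⟩, hw⟩ := Metric.mem_closure_iff.1 (hT (b i)) δ hδ
    exact ⟨w, by rwa [← dist_eq_norm]⟩
  choose w hw using happrox
  let K := b.toBasis.constr 𝕜 w
  have hK : ∀ i, K (b i) = w i := fun i => by
    rw [← b.coe_toBasis]
    exact b.toBasis.constr_basis 𝕜 w i
  refine ⟨K, fun x => ?_⟩
  calc ‖T x - G (K x)‖ = ‖∑ i, ⟪b i, x⟫_𝕜 • (T (b i) - G (w i))‖ := by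
        conv_lhs => rw [← b.sum_repr' x]
        simp only [map_sum, map_smul, hK, smul_sub, Finset.sum_sub_distrib]
    _ ≤ ∑ _i, ‖x‖ * δ := norm_sum_le_of_le _ fun i _ => by
        rw [norm_smul]
        gcongr
        · simpa [b.norm_eq_one] using norm_inner_le_norm (𝕜 := 𝕜) (b i) x
        · exact (hw i).le
    _ ≤ ε * ‖x‖ := by
        rw [Finset.sum_const, Finset.card_univ, Fintype.card_fin, nsmul_eq_mul, mul_left_comm,
          mul_comm ε]
        gcongr
        rw [← mul_div_assoc, div_le_iff₀ (by positivity)]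
        linarith

lemma exists_reApplyInnerSelf_le_of_neg {𝕜 E : Type*} [RCLike 𝕜] [NormedAddCommGroup E]
    [InnerProductSpace 𝕜 E] {A : E →L[𝕜] E} {N : Submodule 𝕜 E} [FiniteDimensional 𝕜 N]
    (hA : ∀ x ∈ N, x ≠ 0 → A.reApplyInnerSelf x < 0) :
    ∃ δ > 0, ∀ x ∈ N, A.reApplyInnerSelf x ≤ -δ * ‖x‖ ^ 2 := by
  have : ProperSpace N := FiniteDimensional.proper_rclike 𝕜 N
  have hcont : Continuous fun x : N => A.reApplyInnerSelf x :=
    A.reApplyInnerSelf_continuous.comp continuous_subtype_val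
  have hsphere : ∃ δ > 0, ∀ x ∈ Metric.sphere (0 : N) 1, A.reApplyInnerSelf x ≤ -δ := by
    rcases (Metric.sphere (0 : N) 1).eq_empty_or_nonempty with hempty | hne
    · exact ⟨1, one_pos, by simp [hempty]⟩
    · obtain ⟨x₀, hx₀, hmax⟩ := (isCompact_sphere (0 : N) 1).exists_isMaxOn hne hcont.continuousOn
      have hx₀ne : (x₀ : E) ≠ 0 :=
        Submodule.coe_eq_zero.not.2 (ne_zero_of_mem_unit_sphere ⟨x₀, hx₀⟩)
      exact ⟨-A.reApplyInnerSelf x₀, neg_pos.2 (hA x₀ x₀.2 hx₀ne), fun x hx => by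
        rw [neg_neg]
        exact hmax hx⟩
  obtain ⟨δ, hδ, hle⟩ := hsphere
  refine ⟨δ, hδ, fun x hx => ?_⟩
  rcases eq_or_ne x 0 with rfl | hx0
  · simp [ContinuousLinearMap.reApplyInnerSelf_apply]
  have hunit := hle ((‖x‖ : 𝕜)⁻¹ • ⟨x, hx⟩) (by simp [norm_smul, hx0])
  rw [Submodule.coe_smul, A.reApplyInnerSelf_smul, norm_inv, RCLike.norm_ofReal, abs_norm,
    inv_pow, inv_mul_le_iff₀ (by positivity)] at hunit
  linarith

lemma range_le_closure_map_orthogonal {𝕜 E F : Type*} [RCLike 𝕜] [NormedAddCommGroup E]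
    [InnerProductSpace 𝕜 E] [CompleteSpace E] [NormedAddCommGroup F] [InnerProductSpace 𝕜 F]
    [CompleteSpace F] {L : E →L[𝕜] F} {R : Submodule 𝕜 E} [R.HasOrthogonalProjection]
    (hdisj : Disjoint R (L.adjoint).range) :
    L.range ≤ (Rᗮ.map (L : E →ₗ[𝕜] F)).topologicalClosure := by
  rw [← Submodule.orthogonal_orthogonal_eq_closure]
  rintro _ ⟨x, rfl⟩ y hy
  have hLy : L.adjoint y ∈ R := by
    rw [← R.orthogonal_orthogonal, Submodule.mem_orthogonal]
    intro z hz
    rw [ContinuousLinearMap.adjoint_inner_right]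
    exact hy (L z) (Submodule.mem_map_of_mem hz)
  have hzero : L.adjoint y = 0 := Submodule.disjoint_def.1 hdisj _ hLy ⟨y, rfl⟩
  rw [ContinuousLinearMap.coe_coe, ← ContinuousLinearMap.adjoint_inner_left, hzero, inner_zero_left]

variable {E F : Type*} [NormedAddCommGroup E] [InnerProductSpace ℂ E] [CompleteSpace E]
  [NormedAddCommGroup F] [InnerProductSpace ℂ F] [CompleteSpace F]
  {L : E →L[ℂ] F} {V : E →L[ℂ] E}

lemma finiteDimensional_negativeSpectralSubspace (hV : IsSelfAdjoint V)
    [FiniteDimensional ℂ V.range] : FiniteDimensional ℂ (negativeSpectralSubspace V) := by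
  refine FiniteDimensional.of_injective
    ((V : E →ₗ[ℂ] E).rangeRestrict ∘ₗ (negativeSpectralSubspace V).subtype) ?_
  rw [injective_iff_map_eq_zero]
  intro x hx
  by_contra hx0
  have hVx : V x = 0 := congrArg Subtype.val hx
  have hneg := reApplyInnerSelf_neg_of_mem_negativeSpectralSubspace hV x.2
    (Submodule.coe_eq_zero.not.2 hx0)
  rw [V.reApplyInnerSelf_apply, hVx, inner_zero_left, map_zero] at hneg
  exact hneg.false

lemma reApplyInnerSelf_adjoint_comp_add_sub (hV : IsSelfAdjoint V) (x : E) {k : E}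
    (hk : V k = 0) :
    (L.adjoint ∘L L + V).reApplyInnerSelf (x - k) = ‖L x - L k‖ ^ 2 + V.reApplyInnerSelf x := by
  have hVxk : ⟪V (x - k), x - k⟫_ℂ = ⟪V x, x⟫_ℂ := by
    rw [map_sub, hk, sub_zero, inner_sub_right, ← hV.adjoint_eq,
      ContinuousLinearMap.adjoint_inner_left _ k, hk, inner_zero_right, sub_zero]
  rw [← map_sub, L.apply_norm_sq_eq_inner_adjoint_left]
  simp only [ContinuousLinearMap.reApplyInnerSelf_apply, add_apply, inner_add_left, map_add, hVxk]

theorem negativeMultiplicity_le_adjoint_comp_add (hV : IsSelfAdjoint V)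
    [FiniteDimensional ℂ V.range] (hdisj : Disjoint V.range (L.adjoint).range) :
    negativeMultiplicity V ≤ negativeMultiplicity (L.adjoint ∘L L + V) := by
  have := finiteDimensional_negativeSpectralSubspace hV
  obtain ⟨δ, hδ, hVneg⟩ := exists_reApplyInnerSelf_le_of_neg
    fun x => reApplyInnerSelf_neg_of_mem_negativeSpectralSubspace hV (x := x)
  have hdense : ∀ x : negativeSpectralSubspace V, L x ∈
      (LinearMap.range ((L : E →ₗ[ℂ] F) ∘ₗ V.ker.subtype)).topologicalClosure := fun x => by
    rw [LinearMap.range_comp, Submodule.range_subtype]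
    have := range_le_closure_map_orthogonal hdisj ⟨x, rfl⟩
    rwa [ContinuousLinearMap.orthogonal_range, hV.adjoint_eq] at this
  obtain ⟨K, hK⟩ := exists_linearMap_norm_sub_le
    ((L : E →ₗ[ℂ] F) ∘ₗ (negativeSpectralSubspace V).subtype) _ hdense
    (half_pos (Real.sqrt_pos.2 hδ))
  refine toENat_rank_le_negativeMultiplicity
    ((ContinuousLinearMap.isPositive_adjoint_comp_self L).isSelfAdjoint.add hV)
    ((negativeSpectralSubspace V).subtype - V.ker.subtype ∘ₗ K) fun x hx => ?_
  have hxpos : 0 < ‖x‖ := norm_pos_iff.2 hx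
  calc (L.adjoint ∘L L + V).reApplyInnerSelf (x - K x)
      = ‖L x - L (K x)‖ ^ 2 + V.reApplyInnerSelf x :=
        reApplyInnerSelf_adjoint_comp_add_sub hV _ (K x).2
    _ ≤ (√δ / 2 * ‖x‖) ^ 2 + -δ * ‖x‖ ^ 2 := by
        gcongr
        · exact hK x
        · exact hVneg x x.2
    _ < 0 := by
        rw [mul_pow, div_pow, Real.sq_sqrt hδ.le]
        nlinarith [mul_pos hδ (pow_pos hxpos 2)]

theorem negativeMultiplicity_adjoint_comp_add (hV : IsSelfAdjoint V)
    [FiniteDimensional ℂ V.range] (hdisj : Disjoint V.range (L.adjoint).range) :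
    negativeMultiplicity (L.adjoint ∘L L + V) = negativeMultiplicity V :=
  (negativeMultiplicity_add_le (ContinuousLinearMap.isPositive_adjoint_comp_self L) hV).antisymm
    (negativeMultiplicity_le_adjoint_comp_add hV hdisj)

end FiniteRankPerturbation

section SchurKernel

variable {𝕜 α β : Type*} [RCLike 𝕜] [MeasurableSpace α] [MeasurableSpace β]
  {μ : Measure α} {ν : Measure β} {k : α → β → 𝕜}

/-- The hypothesis of the Schur test on the kernel `k` of an integral operator
`f ↦ ∫ s, k · s * f s ∂ν` from `L²(ν)` to `L²(μ)`, with weights `p` and `q`. -/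
structure IsSchurKernel (k : α → β → 𝕜) (μ : Measure α) (ν : Measure β) : Prop where
  measurable : Measurable (Function.uncurry k)
  exists_weights : ∃ (p : α → ℝ≥0∞) (q : β → ℝ≥0∞) (C : ℝ≥0), Measurable p ∧ Measurable q ∧
    (∀ᵐ t ∂μ, p t ≠ 0 ∧ p t ≠ ∞) ∧ (∀ᵐ s ∂ν, q s ≠ 0 ∧ q s ≠ ∞) ∧
    (∀ᵐ t ∂μ, ∫⁻ s, ‖k t s‖ₑ * q s ∂ν ≤ C * p t) ∧
    (∀ᵐ s ∂ν, ∫⁻ t, ‖k t s‖ₑ * p t ∂μ ≤ C * q s)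

lemma eLpNorm_two_sq_eq_lintegral {E : Type*} [NormedAddCommGroup E] (f : α → E) :
    eLpNorm f 2 μ ^ 2 = ∫⁻ t, ‖f t‖ₑ ^ 2 ∂μ := by
  simpa using eLpNorm_nnreal_pow_eq_lintegral (μ := μ) (f := f) (two_ne_zero (α := ℝ≥0))

lemma lintegral_mul_sq_le {a w F : β → ℝ≥0∞} (ha : AEMeasurable a ν) (hw : AEMeasurable w ν)
    (hF : AEMeasurable F ν) (hw0 : ∀ᵐ s ∂ν, w s ≠ 0 ∧ w s ≠ ∞) :
    (∫⁻ s, a s * F s ∂ν) ^ 2 ≤ (∫⁻ s, a s * w s ∂ν) * ∫⁻ s, a s * ((w s)⁻¹ * F s ^ 2) ∂ν := by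
  have hsqrt : ∀ᵐ s ∂ν, a s * F s =
      (a s * w s) ^ (1 / 2 : ℝ) * (a s * ((w s)⁻¹ * F s ^ 2)) ^ (1 / 2 : ℝ) := by
    filter_upwards [hw0] with s hs
    have hsq : a s * w s * (a s * ((w s)⁻¹ * F s ^ 2)) = (a s * F s) ^ (2 : ℝ) := by
      calc _ = w s * (w s)⁻¹ * (a s * F s) ^ 2 := by ring
        _ = (a s * F s) ^ (2 : ℝ) := by
          rw [ENNReal.mul_inv_cancel hs.1 hs.2, one_mul, ENNReal.rpow_two]
    rw [← ENNReal.mul_rpow_of_nonneg _ _ (by norm_num), hsq, ← ENNReal.rpow_mul]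
    norm_num
  calc (∫⁻ s, a s * F s ∂ν) ^ 2
      ≤ ((∫⁻ s, a s * w s ∂ν) ^ (1 / 2 : ℝ) *
          (∫⁻ s, a s * ((w s)⁻¹ * F s ^ 2) ∂ν) ^ (1 / 2 : ℝ)) ^ 2 := by
        rw [lintegral_congr_ae hsqrt]
        gcongr
        exact ENNReal.lintegral_mul_norm_pow_le (ha.mul hw)
          (ha.mul (hw.inv.mul (hF.pow_const 2))) (by norm_num) (by norm_num) (by norm_num)
    _ = _ := by
        rw [mul_pow, ← ENNReal.rpow_mul_natCast, ← ENNReal.rpow_mul_natCast]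
        norm_num

namespace IsSchurKernel

lemma swap (hk : IsSchurKernel k μ ν) :
    IsSchurKernel (fun s t => (starRingEnd 𝕜) (k t s)) ν μ := by
  obtain ⟨p, q, C, hp, hq, hp0, hq0, hkq, hkp⟩ := hk.exists_weights
  refine ⟨RCLike.continuous_conj.measurable.comp (hk.measurable.comp measurable_swap),
    q, p, C, hq, hp, hq0, hp0, ?_, ?_⟩
  all_goals simpa only [RCLike.enorm_conj]

lemma aestronglyMeasurable_mul (hk : IsSchurKernel k μ ν) {f : β → 𝕜}
    (hf : AEStronglyMeasurable f ν) (t : α) : AEStronglyMeasurable (fun s => k t s * f s) ν :=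
  (hk.measurable.comp measurable_prodMk_left).aestronglyMeasurable.mul hf

variable [SFinite ν]

lemma aemeasurable_lintegral (hk : IsSchurKernel k μ ν) {f : β → 𝕜}
    (hf : AEStronglyMeasurable f ν) :
    AEMeasurable (fun t => ∫⁻ s, ‖k t s‖ₑ * ‖f s‖ₑ ∂ν) μ :=
  AEMeasurable.lintegral_prod_right' (f := fun z : α × β => ‖k z.1 z.2‖ₑ * ‖f z.2‖ₑ)
    (hk.measurable.enorm.aemeasurable.mul hf.enorm.comp_snd)

variable [SFinite μ]

lemma exists_lintegral_sq_le (hk : IsSchurKernel k μ ν) : ∃ C : ℝ≥0, ∀ F : β → ℝ≥0∞,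
    AEMeasurable F ν → ∫⁻ t, (∫⁻ s, ‖k t s‖ₑ * F s ∂ν) ^ 2 ∂μ ≤ C * ∫⁻ s, F s ^ 2 ∂ν := by
  obtain ⟨p, q, C, hp, hq, -, hq0, hkq, hkp⟩ := hk.exists_weights
  have hkm : Measurable fun z : α × β => ‖k z.1 z.2‖ₑ := hk.measurable.enorm
  refine ⟨C * C, fun F hF => ?_⟩
  calc ∫⁻ t, (∫⁻ s, ‖k t s‖ₑ * F s ∂ν) ^ 2 ∂μ
      ≤ ∫⁻ t, C * p t * ∫⁻ s, ‖k t s‖ₑ * ((q s)⁻¹ * F s ^ 2) ∂ν ∂μ := by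
        refine lintegral_mono_ae ?_
        filter_upwards [hkq] with t ht
        have hkt : Measurable fun s => ‖k t s‖ₑ := hkm.comp measurable_prodMk_left
        exact (lintegral_mul_sq_le hkt.aemeasurable hq.aemeasurable hF hq0).trans (by gcongr)
    _ = ∫⁻ t, ∫⁻ s, C * p t * (‖k t s‖ₑ * ((q s)⁻¹ * F s ^ 2)) ∂ν ∂μ := by
        refine lintegral_congr fun t => (lintegral_const_mul'' _ ?_).symm
        exact (hkm.comp measurable_prodMk_left).aemeasurable.mul
          (hq.inv.aemeasurable.mul (hF.pow_const 2))
    _ = ∫⁻ s, ∫⁻ t, C * p t * (‖k t s‖ₑ * ((q s)⁻¹ * F s ^ 2)) ∂μ ∂ν := by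
        refine lintegral_lintegral_swap ?_
        exact ((hp.const_mul _).comp measurable_fst).aemeasurable.mul
          (hkm.aemeasurable.mul ((hq.inv.aemeasurable.mul (hF.pow_const 2)).comp_snd))
    _ = ∫⁻ s, C * ((q s)⁻¹ * F s ^ 2) * ∫⁻ t, ‖k t s‖ₑ * p t ∂μ ∂ν := by
        refine lintegral_congr fun s => ?_
        have hks : Measurable fun t => ‖k t s‖ₑ := hkm.comp measurable_prodMk_right
        exact (lintegral_congr fun t => by ring).trans (lintegral_const_mul _ (hks.mul hp))
    _ ≤ ∫⁻ s, ↑(C * C) * F s ^ 2 ∂ν := by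
        refine lintegral_mono_ae ?_
        filter_upwards [hkp, hq0] with s hs hs0
        calc C * ((q s)⁻¹ * F s ^ 2) * ∫⁻ t, ‖k t s‖ₑ * p t ∂μ
            ≤ C * ((q s)⁻¹ * F s ^ 2) * (C * q s) := by gcongr
          _ = C * C * (q s * (q s)⁻¹) * F s ^ 2 := by ring
          _ = ↑(C * C) * F s ^ 2 := by
            rw [ENNReal.mul_inv_cancel hs0.1 hs0.2, mul_one, ENNReal.coe_mul]
    _ = _ := lintegral_const_mul' _ _ ENNReal.coe_ne_top

lemma lintegral_sq_lt_top (hk : IsSchurKernel k μ ν) {f : β → 𝕜} (hf : MemLp f 2 ν) :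
    ∫⁻ t, (∫⁻ s, ‖k t s‖ₑ * ‖f s‖ₑ ∂ν) ^ 2 ∂μ < ∞ := by
  obtain ⟨C, hC⟩ := hk.exists_lintegral_sq_le
  refine (hC _ hf.1.enorm).trans_lt (ENNReal.mul_lt_top ENNReal.coe_lt_top ?_)
  rw [← eLpNorm_two_sq_eq_lintegral]
  exact ENNReal.pow_lt_top hf.2

lemma ae_integrable_mul (hk : IsSchurKernel k μ ν) {f : β → 𝕜} (hf : MemLp f 2 ν) :
    ∀ᵐ t ∂μ, Integrable (fun s => k t s * f s) ν := by
  filter_upwards [ae_lt_top' ((hk.aemeasurable_lintegral hf.1).pow_const 2)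
    (hk.lintegral_sq_lt_top hf).ne] with t ht
  refine ⟨hk.aestronglyMeasurable_mul hf.1 t, ?_⟩
  rw [ENNReal.pow_lt_top_iff] at ht
  simpa only [hasFiniteIntegral_iff_enorm, enorm_mul] using ht.resolve_right two_ne_zero

lemma exists_eLpNorm_integral_le (hk : IsSchurKernel k μ ν) : ∃ C : ℝ≥0, ∀ f : β → 𝕜,
    AEStronglyMeasurable f ν →
      eLpNorm (fun t => ∫ s, k t s * f s ∂ν) 2 μ ≤ C * eLpNorm f 2 ν := by
  obtain ⟨C, hC⟩ := hk.exists_lintegral_sq_le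
  refine ⟨NNReal.sqrt C, fun f hf => (ENNReal.pow_le_pow_left_iff two_ne_zero).1 ?_⟩
  calc eLpNorm (fun t => ∫ s, k t s * f s ∂ν) 2 μ ^ 2
      = ∫⁻ t, ‖∫ s, k t s * f s ∂ν‖ₑ ^ 2 ∂μ := eLpNorm_two_sq_eq_lintegral _
    _ ≤ ∫⁻ t, (∫⁻ s, ‖k t s‖ₑ * ‖f s‖ₑ ∂ν) ^ 2 ∂μ := by
        simp only [← enorm_mul]
        gcongr
        exact enorm_integral_le_lintegral_enorm _
    _ ≤ C * ∫⁻ s, ‖f s‖ₑ ^ 2 ∂ν := hC _ hf.enorm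
    _ = (NNReal.sqrt C * eLpNorm f 2 ν) ^ 2 := by
        rw [mul_pow, eLpNorm_two_sq_eq_lintegral, ← ENNReal.coe_pow, NNReal.sq_sqrt]

lemma memLp_integral (hk : IsSchurKernel k μ ν) {f : β → 𝕜} (hf : MemLp f 2 ν) :
    MemLp (fun t => ∫ s, k t s * f s ∂ν) 2 μ := by
  obtain ⟨C, hC⟩ := hk.exists_eLpNorm_integral_le
  refine ⟨?_, (hC f hf.1).trans_lt (ENNReal.mul_lt_top ENNReal.coe_lt_top hf.2)⟩
  exact (hk.measurable.aestronglyMeasurable.mul hf.1.comp_snd).integral_prod_right'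

/-- The integral operator from `L²(ν)` to `L²(μ)` with kernel `k`. -/
def integralOperator (hk : IsSchurKernel k μ ν) : Lp 𝕜 2 ν →L[𝕜] Lp 𝕜 2 μ :=
  LinearMap.mkContinuousOfExistsBound
    { toFun := fun f => (hk.memLp_integral (Lp.memLp f)).toLp
      map_add' := fun f g => by
        rw [← MemLp.toLp_add]
        refine MemLp.toLp_congr _ _ ?_
        filter_upwards [hk.ae_integrable_mul (Lp.memLp f), hk.ae_integrable_mul (Lp.memLp g)]
          with t hf hg
        rw [Pi.add_apply, ← integral_add hf hg]
        refine integral_congr_ae ?_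
        filter_upwards [Lp.coeFn_add f g] with s hs
        rw [hs, Pi.add_apply, mul_add]
      map_smul' := fun c f => by
        rw [RingHom.id_apply, ← MemLp.toLp_const_smul]
        refine MemLp.toLp_congr _ _ (Eventually.of_forall fun t => ?_)
        rw [Pi.smul_apply, ← integral_smul]
        refine integral_congr_ae ?_
        filter_upwards [Lp.coeFn_smul c f] with s hs
        rw [hs, Pi.smul_apply, mul_smul_comm] }
    (by
      obtain ⟨C, hC⟩ := hk.exists_eLpNorm_integral_le
      refine ⟨C, fun f => ?_⟩
      rw [LinearMap.coe_mk, AddHom.coe_mk, Lp.norm_toLp, Lp.norm_def, ← ENNReal.coe_toReal,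
        ← ENNReal.toReal_mul]
      exact ENNReal.toReal_mono (ENNReal.mul_ne_top ENNReal.coe_ne_top (Lp.eLpNorm_ne_top f))
        (hC f (Lp.aestronglyMeasurable f)))

lemma coeFn_integralOperator (hk : IsSchurKernel k μ ν) (f : Lp 𝕜 2 ν) :
    hk.integralOperator f =ᵐ[μ] fun t => ∫ s, k t s * f s ∂ν :=
  MemLp.coeFn_toLp (hk.memLp_integral (Lp.memLp f))

lemma integrable_conj_mul_kernel_mul (hk : IsSchurKernel k μ ν) {f : β → 𝕜} {g : α → 𝕜}
    (hf : MemLp f 2 ν) (hg : MemLp g 2 μ) :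
    Integrable (fun z : α × β => (starRingEnd 𝕜) (g z.1) * (k z.1 z.2 * f z.2)) (μ.prod ν) := by
  have hmeas : AEStronglyMeasurable
      (fun z : α × β => (starRingEnd 𝕜) (g z.1) * (k z.1 z.2 * f z.2)) (μ.prod ν) :=
    (RCLike.continuous_conj.comp_aestronglyMeasurable hg.1.comp_fst).mul
      (hk.measurable.aestronglyMeasurable.mul hf.1.comp_snd)
  refine ⟨hmeas, ?_⟩
  rw [hasFiniteIntegral_iff_enorm, lintegral_prod _ hmeas.enorm]
  calc ∫⁻ t, ∫⁻ s, ‖(starRingEnd 𝕜) (g t) * (k t s * f s)‖ₑ ∂ν ∂μ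
      = ∫⁻ t, ‖g t‖ₑ * ∫⁻ s, ‖k t s‖ₑ * ‖f s‖ₑ ∂ν ∂μ := by
        simp only [enorm_mul, RCLike.enorm_conj]
        exact lintegral_congr fun t => lintegral_const_mul' _ _ enorm_ne_top
    _ ≤ (∫⁻ t, ‖g t‖ₑ ^ (2 : ℝ) ∂μ) ^ (1 / 2 : ℝ) *
          (∫⁻ t, (∫⁻ s, ‖k t s‖ₑ * ‖f s‖ₑ ∂ν) ^ (2 : ℝ) ∂μ) ^ (1 / 2 : ℝ) :=
        ENNReal.lintegral_mul_le_Lp_mul_Lq μ Real.HolderConjugate.two_two hg.1.enorm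
          (hk.aemeasurable_lintegral hf.1)
    _ < ∞ := by
        simp only [ENNReal.rpow_two, ← eLpNorm_two_sq_eq_lintegral]
        exact ENNReal.mul_lt_top
          (ENNReal.rpow_lt_top_of_nonneg (by norm_num) (ENNReal.pow_lt_top hg.2).ne)
          (ENNReal.rpow_lt_top_of_nonneg (by norm_num) (hk.lintegral_sq_lt_top hf).ne)

theorem adjoint_integralOperator (hk : IsSchurKernel k μ ν) :
    hk.integralOperator.adjoint = hk.swap.integralOperator := by
  refine ((ContinuousLinearMap.eq_adjoint_iff _ _).2 fun g f => ?_).symm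
  calc ⟪hk.swap.integralOperator g, f⟫_𝕜
      = ∫ s, ∫ t, (starRingEnd 𝕜) (g t) * (k t s * f s) ∂μ ∂ν := by
        rw [L2.inner_def]
        refine integral_congr_ae ?_
        filter_upwards [hk.swap.coeFn_integralOperator g] with s hs
        rw [hs, RCLike.inner_apply, ← integral_conj, ← integral_const_mul]
        refine integral_congr_ae (Eventually.of_forall fun t => ?_)
        simp only [map_mul, RCLike.conj_conj]
        ring
    _ = ∫ t, ∫ s, (starRingEnd 𝕜) (g t) * (k t s * f s) ∂ν ∂μ :=
        (integral_integral_swap (hk.integrable_conj_mul_kernel_mul (Lp.memLp f) (Lp.memLp g))).symm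
    _ = ⟪g, hk.integralOperator f⟫_𝕜 := by
        rw [L2.inner_def]
        refine integral_congr_ae ?_
        filter_upwards [hk.coeFn_integralOperator f] with t ht
        rw [ht, RCLike.inner_apply, integral_const_mul, mul_comm]

end IsSchurKernel

end SchurKernel

section LerchUniqueness

lemma continuous_comp_neg_log {E : Type*} [TopologicalSpace E] [Zero E] {χ : ℝ → E}
    (hχ : Continuous χ) (hzero : χ 0 = 0) (hlim : Tendsto χ atTop (𝓝 0)) :
    Continuous fun x => χ (-Real.log x) := by
  refine continuous_iff_continuousAt.2 fun x => ?_
  rcases eq_or_ne x 0 with rfl | hx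
  · refine continuousAt_iff_punctured_nhds.2 ?_
    rw [Real.log_zero, neg_zero, hzero]
    exact hlim.comp (tendsto_neg_atBot_atTop.comp Real.tendsto_log_nhdsNE_zero)
  · exact hχ.continuousAt.comp (Real.continuousAt_log hx).neg

lemma exists_polynomial_exp_neg_near {χ : ℝ → ℝ} (hχ : Continuous χ) (hzero : χ 0 = 0)
    (hlim : Tendsto χ atTop (𝓝 0)) {ε : ℝ} (hε : 0 < ε) :
    ∃ p : Polynomial ℝ, ∀ s, 0 ≤ s → |p.eval (Real.exp (-s)) - χ s| < ε := by
  obtain ⟨p, hp⟩ := exists_polynomial_near_of_continuousOn 0 1 _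
    (continuous_comp_neg_log hχ hzero hlim).continuousOn ε hε
  refine ⟨p, fun s hs => ?_⟩
  simpa using hp (Real.exp (-s)) ⟨(Real.exp_pos _).le, Real.exp_le_one_iff.2 (neg_nonpos.2 hs)⟩

variable {F : Type*} [NormedAddCommGroup F] [NormedSpace ℝ F] {G : ℝ → F}

lemma integrable_exp_neg_pow_smul (hG : Integrable G halfLine) (n : ℕ) :
    Integrable (fun s => Real.exp (-s) ^ n • G s) halfLine := by
  refine hG.bdd_smul 1 (by fun_prop) ?_
  filter_upwards [ae_restrict_mem measurableSet_Ioi] with s hs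
  rw [Real.norm_of_nonneg (by positivity)]
  exact pow_le_one₀ (Real.exp_pos _).le (Real.exp_le_one_iff.2 (neg_nonpos.2 (le_of_lt hs)))

lemma integrable_eval_exp_neg_smul (hG : Integrable G halfLine) (p : Polynomial ℝ) :
    Integrable (fun s => p.eval (Real.exp (-s)) • G s) halfLine := by
  simp only [Polynomial.eval_eq_sum_range, Finset.sum_smul, mul_smul]
  exact integrable_finsetSum _ fun n _ =>
    (integrable_exp_neg_pow_smul hG n).fun_smul (p.coeff n)

lemma integral_eval_exp_neg_smul_eq_zero (hG : Integrable G halfLine)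
    (hmoment : ∀ n : ℕ, ∫ s in Ioi (0 : ℝ), Real.exp (-s) ^ n • G s = 0) (p : Polynomial ℝ) :
    ∫ s in Ioi (0 : ℝ), p.eval (Real.exp (-s)) • G s = 0 := by
  simp only [Polynomial.eval_eq_sum_range, Finset.sum_smul, mul_smul]
  rw [integral_finsetSum _ fun n _ => (integrable_exp_neg_pow_smul hG n).fun_smul (p.coeff n)]
  simp only [integral_smul, hmoment, smul_zero, Finset.sum_const_zero]

/-- **Lerch's theorem**, by Weierstrass approximation in the variable `e⁻ˢ`. -/
theorem ae_eq_zero_of_integral_exp_neg_pow_smul_eq_zero [CompleteSpace F]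
    (hG : Integrable G halfLine)
    (hmoment : ∀ n : ℕ, ∫ s in Ioi (0 : ℝ), Real.exp (-s) ^ n • G s = 0) :
    G =ᵐ[halfLine] 0 := by
  refine (ae_restrict_iff' measurableSet_Ioi).2 <|
    isOpen_Ioi.ae_eq_zero_of_integral_contDiff_smul_eq_zero
      (IntegrableOn.locallyIntegrableOn hG) fun χ hχ hcompact hsupp => ?_
  have hzero : ∀ s ∉ Ioi (0 : ℝ), χ s = 0 := fun s hs =>
    image_eq_zero_of_notMem_tsupport fun h => hs (hsupp h)
  rw [← setIntegral_eq_integral_of_forall_compl_eq_zero (s := Ioi 0)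
    fun s hs => by rw [hzero s hs, zero_smul], ← norm_le_zero_iff]
  refine le_of_forall_gt_imp_ge_of_dense fun δ hδ => ?_
  let M := ∫ s in Ioi (0 : ℝ), ‖G s‖
  have hM : 0 < M + 1 := add_pos_of_nonneg_of_pos (integral_nonneg fun s => norm_nonneg _) one_pos
  obtain ⟨p, hp⟩ := exists_polynomial_exp_neg_near hχ.continuous (hzero 0 (by simp))
    (hcompact.is_zero_at_infty.mono_left atTop_le_cocompact) (div_pos hδ hM)
  have hχG : Integrable (fun s => χ s • G s) halfLine :=
    hG.smul_of_top_right (hχ.continuous.memLp_top_of_hasCompactSupport hcompact _)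
  calc ‖∫ s in Ioi (0 : ℝ), χ s • G s‖
      = ‖∫ s in Ioi (0 : ℝ), (p.eval (Real.exp (-s)) - χ s) • G s‖ := by
        simp only [sub_smul]
        rw [integral_sub (integrable_eval_exp_neg_smul hG p) hχG,
          integral_eval_exp_neg_smul_eq_zero hG hmoment, zero_sub, norm_neg]
    _ ≤ ∫ s in Ioi (0 : ℝ), δ / (M + 1) * ‖G s‖ := by
        refine norm_integral_le_of_norm_le (hG.norm.const_mul _) ?_
        filter_upwards [ae_restrict_mem measurableSet_Ioi] with s hs
        rw [norm_smul]
        gcongr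
        exact (hp s (le_of_lt hs)).le
    _ = δ / (M + 1) * M := integral_const_mul _ _
    _ ≤ δ := by
        rw [div_mul_eq_mul_div, div_le_iff₀ hM]
        exact mul_le_mul_of_nonneg_left (le_add_of_nonneg_right zero_le_one) hδ.le

end LerchUniqueness

section Laplace

lemma integral_exp_neg_mul {a : ℝ} (ha : 0 < a) :
    ∫ t in Ioi (0 : ℝ), Real.exp (-(a * t)) = a⁻¹ := by
  simpa [neg_mul, neg_div_neg_eq] using integral_exp_mul_Ioi (neg_lt_zero.2 ha) 0

lemma integrable_exp_neg_mul {a : ℝ} (ha : 0 < a) :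
    Integrable (fun t : ℝ => Real.exp (-(a * t))) halfLine := by
  have hint := integrableOn_exp_mul_Ioi (neg_lt_zero.2 ha) 0
  simp only [neg_mul] at hint
  exact hint

lemma lintegral_exp_neg_mul_rpow {t : ℝ} (ht : 0 < t) :
    ∫⁻ s in Ioi (0 : ℝ), ‖(Real.exp (-(t * s)) : ℂ)‖ₑ * ENNReal.ofReal (s ^ (-(1 / 2) : ℝ)) =
      (√Real.pi).toNNReal * ENNReal.ofReal (t ^ (-(1 / 2) : ℝ)) := by
  have hint : Integrable (fun s => s ^ (-(1 / 2) : ℝ) * Real.exp (-(t * s))) halfLine := by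
    have hint := integrableOn_rpow_mul_exp_neg_mul_rpow (s := -(1 / 2)) (p := 1) (by norm_num)
      one_pos ht
    simp only [Real.rpow_one, neg_mul] at hint
    exact hint
  calc _ = ∫⁻ s in Ioi (0 : ℝ), ENNReal.ofReal (s ^ (-(1 / 2) : ℝ) * Real.exp (-(t * s))) := by
        refine lintegral_congr fun s => ?_
        rw [mul_comm (s ^ _), ENNReal.ofReal_mul (Real.exp_pos _).le, ← ofReal_norm,
          Complex.norm_real, Real.norm_of_nonneg (Real.exp_pos _).le]
    _ = ENNReal.ofReal (∫ s in Ioi (0 : ℝ), s ^ (-(1 / 2) : ℝ) * Real.exp (-(t * s))) := by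
        refine (ofReal_integral_eq_lintegral_ofReal hint ?_).symm
        filter_upwards [ae_restrict_mem measurableSet_Ioi] with s hs
        have : 0 < s := hs
        positivity
    _ = ENNReal.ofReal (√Real.pi * t ^ (-(1 / 2) : ℝ)) := by
        have hGamma := Real.integral_rpow_mul_exp_neg_mul_Ioi (a := 1 / 2) (by norm_num) ht
        rw [show (1 / 2 - 1 : ℝ) = -(1 / 2) by norm_num, Real.Gamma_one_half_eq, one_div t,
          Real.inv_rpow ht.le, ← Real.rpow_neg ht.le, mul_comm] at hGamma
        rw [hGamma]
    _ = _ := ENNReal.ofReal_mul (Real.sqrt_nonneg _)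

lemma isSchurKernel_laplace :
    IsSchurKernel (fun t s : ℝ => (Real.exp (-(t * s)) : ℂ)) halfLine halfLine := by
  have hweight : Measurable fun s : ℝ => ENNReal.ofReal (s ^ (-(1 / 2) : ℝ)) := by fun_prop
  have hpos : ∀ᵐ s ∂halfLine,
      ENNReal.ofReal (s ^ (-(1 / 2) : ℝ)) ≠ 0 ∧ ENNReal.ofReal (s ^ (-(1 / 2) : ℝ)) ≠ ∞ := by
    filter_upwards [ae_restrict_mem measurableSet_Ioi] with s hs
    exact ⟨(ENNReal.ofReal_pos.2 (Real.rpow_pos_of_pos hs _)).ne', ENNReal.ofReal_ne_top⟩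
  refine ⟨by fun_prop, _, _, (√Real.pi).toNNReal, hweight, hweight, hpos, hpos, ?_, ?_⟩
  · filter_upwards [ae_restrict_mem measurableSet_Ioi] with t ht
    exact (lintegral_exp_neg_mul_rpow ht).le
  · filter_upwards [ae_restrict_mem measurableSet_Ioi] with s hs
    simp only [mul_comm _ s]
    exact (lintegral_exp_neg_mul_rpow hs).le

/-- The Laplace transform on `L²(ℝ₊)`. -/
def laplace : L2Pos →L[ℂ] L2Pos :=
  isSchurKernel_laplace.integralOperator

lemma coeFn_laplace (f : L2Pos) :
    laplace f =ᵐ[halfLine] fun t => ∫ s in Ioi (0 : ℝ), (Real.exp (-(t * s)) : ℂ) * f s :=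
  isSchurKernel_laplace.coeFn_integralOperator f

lemma adjoint_laplace : laplace.adjoint = laplace := by
  rw [laplace, IsSchurKernel.adjoint_integralOperator]
  congr 1
  simp only [Complex.conj_ofReal, mul_comm]

lemma integral_exp_mul_integral_exp_mul {f : ℝ → ℂ} (hf : AEStronglyMeasurable f halfLine) {t : ℝ}
    (ht : 0 < t) (hint : Integrable (fun s => (((t + s)⁻¹ : ℝ) : ℂ) * f s) halfLine) :
    ∫ u in Ioi (0 : ℝ), (Real.exp (-(t * u)) : ℂ) *
        ∫ s in Ioi (0 : ℝ), (Real.exp (-(u * s)) : ℂ) * f s =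
      ∫ s in Ioi (0 : ℝ), (((t + s)⁻¹ : ℝ) : ℂ) * f s := by
  have hmeas : AEStronglyMeasurable
      (fun z : ℝ × ℝ => (Real.exp (-((t + z.2) * z.1)) : ℂ) * f z.2) (halfLine.prod halfLine) :=
    (Measurable.aestronglyMeasurable (by fun_prop)).mul hf.comp_snd
  have hjoint : Integrable (fun z : ℝ × ℝ => (Real.exp (-((t + z.2) * z.1)) : ℂ) * f z.2)
      (halfLine.prod halfLine) := by
    refine (integrable_prod_iff' hmeas).2 ⟨?_, ?_⟩
    · filter_upwards [ae_restrict_mem measurableSet_Ioi] with s hs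
      exact (integrable_exp_neg_mul (add_pos ht hs)).ofReal.mul_const _
    · refine hint.norm.congr ?_
      filter_upwards [ae_restrict_mem measurableSet_Ioi] with s hs
      have hts : 0 < t + s := add_pos ht hs
      simp only [norm_mul, Complex.norm_real, Real.norm_of_nonneg (Real.exp_pos _).le]
      rw [integral_mul_const, integral_exp_neg_mul hts, Real.norm_of_nonneg (inv_nonneg.2 hts.le)]
  calc _ = ∫ u in Ioi (0 : ℝ), ∫ s in Ioi (0 : ℝ), (Real.exp (-((t + s) * u)) : ℂ) * f s := by
        refine integral_congr_ae (Eventually.of_forall fun u => ?_)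
        simp only [← integral_const_mul, ← mul_assoc, ← Complex.ofReal_mul, ← Real.exp_add]
        congr! 5
        ring
    _ = ∫ s in Ioi (0 : ℝ), ∫ u in Ioi (0 : ℝ), (Real.exp (-((t + s) * u)) : ℂ) * f s :=
        integral_integral_swap hjoint
    _ = _ := by
        refine setIntegral_congr_fun measurableSet_Ioi fun s hs => ?_
        rw [integral_mul_const, integral_complex_ofReal, integral_exp_neg_mul (add_pos ht hs)]

theorem carleman_eq_adjoint_laplace_comp_laplace : carleman = laplace.adjoint ∘L laplace := by
  refine ContinuousLinearMap.ext fun f => Lp.ext ?_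
  rw [adjoint_laplace, ContinuousLinearMap.comp_apply]
  filter_upwards [carleman_apply f, coeFn_laplace (laplace f), ae_integrable_kernel_mul f,
    ae_restrict_mem measurableSet_Ioi] with t hcarleman hlaplace hint ht
  rw [hcarleman, hlaplace, carlemanFun,
    ← integral_exp_mul_integral_exp_mul (Lp.aestronglyMeasurable f) ht hint]
  refine integral_congr_ae ?_
  filter_upwards [coeFn_laplace f] with u hu
  rw [hu]

lemma memLp_exp_neg_mul {t : ℝ} (ht : 0 < t) :
    MemLp (fun s : ℝ => (Real.exp (-(t * s)) : ℂ)) 2 halfLine := by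
  refine (memLp_two_iff_integrable_sq_norm (by fun_prop)).2 ?_
  refine (integrable_exp_neg_mul (mul_pos two_pos ht)).congr (Eventually.of_forall fun s => ?_)
  simp only [Complex.norm_real, Real.norm_of_nonneg (Real.exp_pos _).le]
  rw [sq, ← Real.exp_add]
  congr 1; ring

lemma integrable_exp_neg_mul_mul {f : ℝ → ℂ} (hf : MemLp f 2 halfLine) {t : ℝ} (ht : 0 < t) :
    Integrable (fun s => (Real.exp (-(t * s)) : ℂ) * f s) halfLine :=
  (memLp_exp_neg_mul ht).integrable_mul hf

lemma continuousOn_integral_exp_neg_mul {f : ℝ → ℂ} (hf : MemLp f 2 halfLine) :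
    ContinuousOn (fun t => ∫ s in Ioi (0 : ℝ), (Real.exp (-(t * s)) : ℂ) * f s) (Ioi 0) := by
  refine continuousOn_of_forall_continuousAt fun t₀ (ht₀ : 0 < t₀) => ?_
  refine continuousAt_of_dominated (bound := fun s => ‖(Real.exp (-(t₀ / 2 * s)) : ℂ) * f s‖)
    (Eventually.of_forall fun t => AEStronglyMeasurable.mul (by fun_prop) hf.1) ?_
    (integrable_exp_neg_mul_mul hf (half_pos ht₀)).norm (Eventually.of_forall fun s => by fun_prop)
  filter_upwards [lt_mem_nhds (half_lt_self ht₀)] with t ht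
  filter_upwards [ae_restrict_mem measurableSet_Ioi] with s hs
  have hs0 : 0 ≤ s := le_of_lt hs
  simp only [norm_mul, Complex.norm_real, Real.norm_of_nonneg (Real.exp_pos _).le]
  gcongr

lemma integral_exp_neg_mul_eq_zero_of_laplace_eq_zero {g : L2Pos} (hg : laplace g = 0) {t : ℝ}
    (ht : 0 < t) : ∫ s in Ioi (0 : ℝ), (Real.exp (-(t * s)) : ℂ) * g s = 0 := by
  have hae : (fun t => ∫ s in Ioi (0 : ℝ), (Real.exp (-(t * s)) : ℂ) * g s) =ᵐ[halfLine] 0 :=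
    (coeFn_laplace g).symm.trans (Lp.eq_zero_iff_ae_eq_zero.1 hg)
  exact Measure.eqOn_open_of_ae_eq hae isOpen_Ioi
    (continuousOn_integral_exp_neg_mul (Lp.memLp g)) continuousOn_const ht

theorem injective_laplace : Function.Injective laplace := by
  refine (injective_iff_map_eq_zero _).2 fun g hg => Lp.eq_zero_iff_ae_eq_zero.2 ?_
  have hG := ae_eq_zero_of_integral_exp_neg_pow_smul_eq_zero
    (integrable_exp_neg_mul_mul (Lp.memLp g) one_pos) fun n => by
      refine Eq.trans ?_ (integral_exp_neg_mul_eq_zero_of_laplace_eq_zero hg n.cast_add_one_pos)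
      refine integral_congr_ae (Eventually.of_forall fun s => ?_)
      simp only
      rw [Complex.real_smul, ← mul_assoc, ← Complex.ofReal_mul, ← Real.exp_nat_mul, ← Real.exp_add]
      congr 3; ring
  filter_upwards [hG] with s hs
  exact (mul_eq_zero.1 hs).resolve_left (Complex.ofReal_ne_zero.2 (Real.exp_ne_zero _))

end Laplace

section TestFunctions

lemma setIntegral_mul_eq_integral_of_tsupport_subset {φ : ℝ → ℂ} {s : Set ℝ} (hφ : tsupport φ ⊆ s)
    (g : ℝ → ℂ) : ∫ t in s, g t * φ t = ∫ t, g t * φ t := by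
  refine setIntegral_eq_integral_of_forall_compl_eq_zero fun t ht => ?_
  rw [image_eq_zero_of_notMem_tsupport fun h => ht (hφ h), mul_zero]

lemma eq_zero_of_forall_setIntegral_test_mul_eq_zero {g : L2Pos}
    (h : ∀ ψ : ℝ → ℂ, Continuous ψ → HasCompactSupport ψ → tsupport ψ ⊆ Ioi 0 →
      ∫ s in Ioi (0 : ℝ), g s * ψ s = 0) : g = 0 := by
  have hloc : LocallyIntegrableOn g (Ioi 0) :=
    locallyIntegrableOn_of_locallyIntegrable_restrict ((Lp.memLp g).locallyIntegrable one_le_two)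
  refine Lp.eq_zero_iff_ae_eq_zero.2 <| (ae_restrict_iff' measurableSet_Ioi).2 <|
    isOpen_Ioi.ae_eq_zero_of_integral_contDiff_smul_eq_zero hloc fun χ hχ hcompact hsupp => ?_
  have hsupp' : tsupport (fun s => (χ s : ℂ)) ⊆ Ioi 0 :=
    (tsupport_comp_subset Complex.ofReal_zero χ).trans hsupp
  have hzero := h (fun s => χ s) (Complex.continuous_ofReal.comp hχ.continuous)
    (hcompact.comp_left Complex.ofReal_zero) hsupp'
  rw [setIntegral_mul_eq_integral_of_tsupport_subset hsupp'] at hzero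
  simpa only [Complex.real_smul, mul_comm] using hzero

lemma ext_of_forall_test {F : Type*} [NormedAddCommGroup F] [NormedSpace ℂ F]
    {A B : L2Pos →L[ℂ] F}
    (h : ∀ φ : ℝ → ℂ, Continuous φ → HasCompactSupport φ → tsupport φ ⊆ Ioi 0 →
      ∀ f : L2Pos, f =ᵐ[halfLine] φ → A f = B f) : A = B := by
  have : CompleteSpace (A - B).ker := (A - B).isClosed_ker.completeSpace_coe
  suffices hker : (A - B).ker = ⊤ from
    sub_eq_zero.1 (ContinuousLinearMap.coe_injective (LinearMap.ker_eq_top.1 hker))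
  refine Submodule.orthogonal_eq_bot_iff.1 (eq_bot_iff.2 fun g hg => ?_)
  refine eq_zero_of_forall_setIntegral_test_mul_eq_zero fun ψ hψ hcompact hsupp => ?_
  have hconj : Continuous fun s => starRingEnd ℂ (ψ s) := hψ.star
  have hconjcompact : HasCompactSupport fun s => starRingEnd ℂ (ψ s) :=
    hcompact.comp_left (map_zero _)
  have hmem : MemLp (fun s => starRingEnd ℂ (ψ s)) 2 halfLine :=
    hconj.memLp_of_hasCompactSupport hconjcompact
  have hker : hmem.toLp _ ∈ (A - B).ker := sub_eq_zero.2 <|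
    h _ hconj hconjcompact ((tsupport_comp_subset (map_zero _) ψ).trans hsupp) _ hmem.coeFn_toLp
  rw [← hg _ hker, L2.inner_def]
  refine integral_congr_ae ?_
  filter_upwards [hmem.coeFn_toLp] with s hs
  rw [hs, RCLike.inner_apply, RCLike.conj_conj]

end TestFunctions

section Shift

lemma measurePreserving_add_right_halfLine (a : ℝ≥0) :
    MeasurePreserving (· + (a : ℝ)) halfLine (halfLine.restrict (Ioi (a : ℝ))) := by
  have hpres := (measurePreserving_add_right volume (a : ℝ)).restrict_preimage
    (measurableSet_Ioi (a := (a : ℝ)))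
  rwa [preimage_add_const_Ioi, sub_self,
    ← inter_eq_left.2 (Ioi_subset_Ioi a.coe_nonneg), ← Measure.restrict_restrict measurableSet_Ioi]
    at hpres

lemma ae_halfLine_add {p : ℝ → Prop} (hp : ∀ᵐ t ∂halfLine, p t) (a : ℝ≥0) :
    ∀ᵐ t ∂halfLine, p (t + a) :=
  (measurePreserving_add_right_halfLine a).quasiMeasurePreserving.ae (ae_restrict_of_ae hp)

/-- The backward shift `f ↦ f (· + a)` on `L²(ℝ₊)`: restrict to `(a, ∞)`, then translate. -/
def shift (a : ℝ≥0) : L2Pos →L[ℂ] L2Pos :=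
  (Lp.compMeasurePreservingₗᵢ ℂ _ (measurePreserving_add_right_halfLine a)).toContinuousLinearMap ∘L
    LpToLpRestrictCLM ℝ ℂ ℂ halfLine 2 (Ioi (a : ℝ))

lemma coeFn_shift (a : ℝ≥0) (f : L2Pos) : shift a f =ᵐ[halfLine] fun t => f (t + a) := by
  have hpres := measurePreserving_add_right_halfLine a
  exact (Lp.coeFn_compMeasurePreserving _ hpres).trans
    (hpres.quasiMeasurePreserving.ae_eq (LpToLpRestrictCLM_coeFn ℂ (Ioi (a : ℝ)) f))

lemma tsupport_comp_sub_subset {φ : ℝ → ℂ} (hφ : tsupport φ ⊆ Ioi 0) (a : ℝ≥0) :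
    tsupport (fun t => φ (t - a)) ⊆ Ioi 0 := by
  refine (tsupport_comp_subset_preimage φ (continuous_sub_right (a : ℝ))).trans fun t ht => ?_
  exact a.coe_nonneg.trans_lt (sub_pos.1 (hφ ht))

lemma coeFn_adjoint_shift {φ : ℝ → ℂ} (hφ : Continuous φ) (hcompact : HasCompactSupport φ)
    (hsupp : tsupport φ ⊆ Ioi 0) {f : L2Pos} (hf : f =ᵐ[halfLine] φ) (a : ℝ≥0) :
    (shift a).adjoint f =ᵐ[halfLine] fun t => φ (t - a) := by
  have hmem : MemLp (fun t => φ (t - a)) 2 halfLine :=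
    (hφ.comp (continuous_sub_right (a : ℝ))).memLp_of_hasCompactSupport
      (hcompact.comp_homeomorph (Homeomorph.subRight (a : ℝ)))
  suffices hadj : (shift a).adjoint f = hmem.toLp _ from hadj ▸ hmem.coeFn_toLp
  refine ext_inner_left ℂ fun g => ?_
  rw [ContinuousLinearMap.adjoint_inner_right, L2.inner_def, L2.inner_def]
  calc ∫ t in Ioi (0 : ℝ), ⟪shift a g t, f t⟫_ℂ
      = ∫ t in Ioi (0 : ℝ), starRingEnd ℂ (g (t + a)) * φ t := by
        refine integral_congr_ae ?_
        filter_upwards [coeFn_shift a g, hf] with t hshift ht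
        rw [hshift, ht, RCLike.inner_apply']
    _ = ∫ t, starRingEnd ℂ (g (t + a)) * φ (t + a - a) := by
        simp only [add_sub_cancel_right, setIntegral_mul_eq_integral_of_tsupport_subset hsupp]
    _ = ∫ t, starRingEnd ℂ (g t) * φ (t - a) :=
        integral_add_right_eq_self (fun t => starRingEnd ℂ (g t) * φ (t - a)) (a : ℝ)
    _ = ∫ t in Ioi (0 : ℝ), starRingEnd ℂ (g t) * φ (t - a) :=
        (setIntegral_mul_eq_integral_of_tsupport_subset (tsupport_comp_sub_subset hsupp a) _).symm
    _ = ∫ t in Ioi (0 : ℝ), ⟪g t, hmem.toLp _ t⟫_ℂ := by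
        refine integral_congr_ae ?_
        filter_upwards [hmem.coeFn_toLp] with t ht
        rw [ht, RCLike.inner_apply']

theorem IsHankel.shift_comp {H : L2Pos →L[ℂ] L2Pos} (hH : IsHankel H) (a : ℝ≥0) :
    shift a ∘L H = H ∘L (shift a).adjoint := by
  obtain ⟨h, -, hker⟩ := hH
  refine ext_of_forall_test fun φ hφ hcompact hsupp f hf => Lp.ext ?_
  have hsupp' := tsupport_comp_sub_subset hsupp a
  refine (coeFn_shift a (H f)).trans ?_
  filter_upwards [ae_halfLine_add (hker φ hφ hcompact hsupp f hf) a,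
    hker _ (hφ.comp (continuous_sub_right (a : ℝ)))
      (hcompact.comp_homeomorph (Homeomorph.subRight (a : ℝ))) hsupp' _
      (coeFn_adjoint_shift hφ hcompact hsupp hf a)] with t hleft hright
  rw [hleft, ContinuousLinearMap.comp_apply, hright]
  simp only [Function.comp_apply]
  rw [setIntegral_mul_eq_integral_of_tsupport_subset hsupp,
    setIntegral_mul_eq_integral_of_tsupport_subset hsupp' fun s => h (t + s),
    ← integral_add_right_eq_self (fun s => h (t + s) * φ (s - a)) (a : ℝ)]
  simp only [add_sub_cancel_right, add_assoc, add_comm (a : ℝ)]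

lemma IsHankel.range_mem_invtSubmodule {H : L2Pos →L[ℂ] L2Pos} (hH : IsHankel H) (a : ℝ≥0) :
    H.range ∈ Module.End.invtSubmodule (shift a : L2Pos →ₗ[ℂ] L2Pos) := by
  rintro _ ⟨f, rfl⟩
  exact ⟨(shift a).adjoint f, (DFunLike.congr_fun (hH.shift_comp a) f).symm⟩

lemma memLp_exp_neg_mul_coeFn (a : ℝ≥0) (g : L2Pos) :
    MemLp (fun s => (Real.exp (-(a * s)) : ℂ) * g s) 2 halfLine := by
  refine (Lp.memLp g).of_le
    ((Measurable.aestronglyMeasurable (by fun_prop)).mul (Lp.aestronglyMeasurable g)) ?_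
  filter_upwards [ae_restrict_mem measurableSet_Ioi] with s hs
  rw [norm_mul, Complex.norm_real, Real.norm_of_nonneg (Real.exp_pos _).le]
  refine mul_le_of_le_one_left (norm_nonneg _) (Real.exp_le_one_iff.2 ?_)
  exact neg_nonpos.2 (mul_nonneg a.coe_nonneg (le_of_lt hs))

lemma shift_laplace (a : ℝ≥0) (g : L2Pos) :
    shift a (laplace g) = laplace ((memLp_exp_neg_mul_coeFn a g).toLp _) := by
  refine Lp.ext ((coeFn_shift a _).trans ?_)
  filter_upwards [ae_halfLine_add (coeFn_laplace g) a,
    coeFn_laplace ((memLp_exp_neg_mul_coeFn a g).toLp _)] with t hleft hright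
  rw [hleft, hright]
  refine integral_congr_ae ?_
  filter_upwards [(memLp_exp_neg_mul_coeFn a g).coeFn_toLp] with s hs
  rw [hs, ← mul_assoc, ← Complex.ofReal_mul, ← Real.exp_add]
  congr 4; ring

lemma eq_zero_of_shift_laplace_eq_smul {a : ℝ≥0} (ha : a ≠ 0) {g : L2Pos} {c : ℂ}
    (h : shift a (laplace g) = c • laplace g) : g = 0 := by
  have hmul : (fun s => (Real.exp (-(a * s)) : ℂ) * g s) =ᵐ[halfLine] fun s => c * g s := by
    rw [shift_laplace, ← map_smul] at h
    have hcoe := (memLp_exp_neg_mul_coeFn a g).coeFn_toLp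
    rw [injective_laplace h] at hcoe
    exact hcoe.symm.trans (Lp.coeFn_smul c g)
  have hne : ∀ᵐ s ∂halfLine, (Real.exp (-(a * s)) : ℂ) ≠ c := by
    have hsub : {s : ℝ | (Real.exp (-(a * s)) : ℂ) = c}.Subsingleton := fun s hs t ht => by
      have hst : (Real.exp (-(a * s)) : ℂ) = Real.exp (-(a * t)) := hs.trans ht.symm
      exact mul_left_cancel₀ (NNReal.coe_ne_zero.2 ha)
        (neg_injective (Real.exp_injective (Complex.ofReal_injective hst)))
    exact measure_eq_zero_iff_ae_notMem.1 (hsub.measure_zero _)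
  refine Lp.eq_zero_iff_ae_eq_zero.2 ?_
  filter_upwards [hmul, hne] with s hs hsne
  exact (mul_eq_mul_right_iff.1 hs).resolve_left hsne

theorem disjoint_range_laplace {a : ℝ≥0} (ha : a ≠ 0) {M : Submodule ℂ L2Pos}
    [FiniteDimensional ℂ M] (hM : M ∈ Module.End.invtSubmodule (shift a : L2Pos →ₗ[ℂ] L2Pos)) :
    Disjoint M laplace.range := by
  have hrange : laplace.range ∈ Module.End.invtSubmodule (shift a : L2Pos →ₗ[ℂ] L2Pos) := by
    rintro _ ⟨g, rfl⟩
    exact ⟨_, (shift_laplace a g).symm⟩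
  have hinv := Module.End.invtSubmodule.inf_mem hM hrange
  rw [disjoint_iff]
  by_contra hbot
  have := Submodule.nontrivial_iff_ne_bot.2 hbot
  obtain ⟨c, hc⟩ := Module.End.exists_eigenvalue ((shift a : L2Pos →ₗ[ℂ] L2Pos).restrict hinv)
  obtain ⟨⟨_, _, g, rfl⟩, hv⟩ := hc.exists_hasEigenvector
  have hg := eq_zero_of_shift_laplace_eq_smul ha (congrArg Subtype.val hv.apply_eq_smul)
  exact hv.2 (Subtype.ext (by simp [hg]))

end Shift

end FiniteRankHankel

end

theorem theorem1p3_general {V : FiniteRankHankel.L2Pos →L[ℂ] FiniteRankHankel.L2Pos}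
    (hV : IsSelfAdjoint V) (hrank : FiniteRankHankel.HasFiniteRank V) {a : NNReal} (ha : a ≠ 0)
    (hinv : V.range ∈ Module.End.invtSubmodule
      (FiniteRankHankel.shift a : FiniteRankHankel.L2Pos →ₗ[ℂ] FiniteRankHankel.L2Pos)) :
    FiniteRankHankel.negativeMultiplicity (FiniteRankHankel.carleman + V) =
        FiniteRankHankel.negativeMultiplicity V ∧
      ((FiniteRankHankel.carleman + V).IsPositive ↔ V.IsPositive) := by
  have : FiniteDimensional ℂ V.range := hrank
  have hdisj : Disjoint V.range FiniteRankHankel.laplace.adjoint.range := by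
    rw [FiniteRankHankel.adjoint_laplace]
    exact FiniteRankHankel.disjoint_range_laplace ha hinv
  have hmult : FiniteRankHankel.negativeMultiplicity (FiniteRankHankel.carleman + V) =
      FiniteRankHankel.negativeMultiplicity V := by
    rw [FiniteRankHankel.carleman_eq_adjoint_laplace_comp_laplace]
    exact FiniteRankHankel.negativeMultiplicity_adjoint_comp_add hV hdisj
  refine ⟨hmult, ?_⟩
  rw [FiniteRankHankel.isPositive_iff_negativeMultiplicity_eq_zero
      (FiniteRankHankel.carleman_isSelfAdjoint.add hV),
    FiniteRankHankel.isPositive_iff_negativeMultiplicity_eq_zero hV, hmult]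

theorem theorem1p3
    (V : FiniteRankHankel.L2Pos →L[ℂ] FiniteRankHankel.L2Pos)
    (hHankel : FiniteRankHankel.IsHankel V)
    (hrank : FiniteRankHankel.HasFiniteRank V)
    (hV : IsSelfAdjoint V) :
    FiniteRankHankel.negativeMultiplicity (FiniteRankHankel.carleman + V) =
        FiniteRankHankel.negativeMultiplicity V ∧
      ((FiniteRankHankel.carleman + V).IsPositive ↔ V.IsPositive) :=
  theorem1p3_general hV hrank one_ne_zero (hHankel.range_mem_invtSubmodule 1)
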